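/- Let $\alpha=(\alpha_n)_{n\ge 0}$ be a sequence of positive real numbers such that the weighted shift $W=W_\alpha$ on $\ell^2(\mathbb{Z}_+)$, $We_n=\alpha_n e_{n+1}$, is bounded, and put $\gamma_n=\alpha_0^2\cdots\alpha_{n-1}^2$ (so $\gamma_0=1$). Assume that $W$ is subnormal (i.e. the restriction of a normal operator to an invariant subspace) with Berger measure $\mu$: a positive Borel measure on $\mathbb{R}$ with $\operatorname{supp}\mu\subseteq[0,\|W\|^2]$ and $\int t^n\,d\mu(t)=\gamma_n$ for all $n\ge 0$. Assume that $\mu$ is finitely atomic (its support is finite), normalized so that $\operatorname{supp}\mu\subseteq[1,\infty)$. Assume finally that the Aluthge transform $\widetilde W=|W|^{1/2}V|W|^{1/2}$ is subnormal, where $W=V|W|$ is the polar decomposition of $W$ ($|W|=(W^*W)^{1/2}$, $V$ a partial isometry with $\ker V=\ker W$). For a finitely atomic positive or signed measure $\rho$ with support in $[1,\infty)$ let $\mathcal{M}_\rho(z)=\int_{(0,\infty)}t^z\,d\rho(t)$, $z\in\mathbb{C}$, be its Mellin transform. Then $\mathcal{M}_\mu$ has an entire square root, i.e. there is an entire function $H$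 with $H(z)^2=\mathcal{M}_\mu(z)$ for all $z\in\mathbb{C}$; and for every such $H$ there is a finitely atomic charge (real signed Borel measure with finite support) $\xi$ on $\mathbb{R}$ with support in $[1,\infty)$ such that $\mathcal{M}_\xi(z)=H(z)$ for all $z\in\mathbb{C}$. In particular $\xi*\xi=\mu$, where $*$ is multiplicative convolution, $(\xi*\eta)(E)=\iint\chi_E(xy)\,d\xi(x)\,d\eta(y)$. -/

import Mathlib

open MeasureTheory Set

universe u

namespace AluthgeShift

/-- The complex Hilbert space of square-summable sequences indexed by the nonnegative integers. -/
abbrev Seq2 : Type := lp (fun _ : ℕ => ℂ) 2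

/-- The canonical orthonormal basis vector `e n` of `Seq2`. -/
noncomputable def e (n : ℕ) : Seq2 := lp.single 2 n (1 : ℂ)

/-- `W` is the (bounded) unilateral weighted shift with positive weights `α`:
`W (e n) = α n • e (n + 1)`. A bounded operator is determined by these values. -/
structure IsWeightedShift (α : ℕ → ℝ) (W : Seq2 →L[ℂ] Seq2) : Prop where
  weight_pos : ∀ n, 0 < α n
  map_basis : ∀ n, W (e n) = (α n : ℂ) • e (n + 1)

/-- A bounded operator `T` is subnormal if it is (up to an isometric identification `J`) the
restriction of a normal operator `N` to an invariant subspace (the range of `J`). Restricting `N`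
to the smallest closed reducing subspace that contains the range of `J`, one sees that the choice
of the universe of `K` is immaterial. -/
def IsSubnormal {H : Type u} [NormedAddCommGroup H] [InnerProductSpace ℂ H] [CompleteSpace H]
    (T : H →L[ℂ] H) : Prop :=
  ∃ (K : Type u) (_ : NormedAddCommGroup K) (_ : InnerProductSpace ℂ K) (_ : CompleteSpace K)
    (N : K →L[ℂ] K) (J : H →ₗᵢ[ℂ] K), IsStarNormal N ∧ ∀ x, N (J x) = J (T x)

/-- `T = V |T|` is the polar decomposition of `T`: here `|T| = (T* T)^(1/2)` and `V` is a partial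
isometry with `ker V = ker T`. -/
structure IsPolarDecomposition {H : Type*} [NormedAddCommGroup H] [InnerProductSpace ℂ H]
    [CompleteSpace H] (T V : H →L[ℂ] H) : Prop where
  eq_mul_abs : T = V * CFC.abs T
  partial_isometry : V * star V * V = V
  ker_eq : ∀ x, V x = 0 ↔ T x = 0

/-- `S` is the Aluthge transform `|T|^(1/2) V |T|^(1/2)` of `T`, where `T = V |T|` is the polar
decomposition of `T`. -/
def IsAluthgeTransform {H : Type*} [NormedAddCommGroup H] [InnerProductSpace ℂ H]
    [CompleteSpace H] (T S : H →L[ℂ] H) : Prop :=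
  ∃ V : H →L[ℂ] H, IsPolarDecomposition T V ∧
    S = CFC.sqrt (CFC.abs T) * V * CFC.sqrt (CFC.abs T)

/-- The sequence `γ 0 = 1`, `γ n = α 0 ^ 2 * ⋯ * α (n - 1) ^ 2` attached to the weights `α`. -/
def gammaSeq (α : ℕ → ℝ) (n : ℕ) : ℝ := ∏ k ∈ Finset.range n, α k ^ 2

/-- `μ` is a Berger measure of the weighted shift `W` with weights `α`: a positive Borel measure
with support in `[0, ‖W‖ ^ 2]` whose `n`-th moment is `γ n` for every `n`. -/
structure IsBergerMeasure (α : ℕ → ℝ) (W : Seq2 →L[ℂ] Seq2) (μ : Measure ℝ) : Prop where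
  support_subset : μ.support ⊆ Icc 0 (‖W‖ ^ 2)
  integrable_pow : ∀ n : ℕ, Integrable (fun t : ℝ => t ^ n) μ
  moment_eq : ∀ n : ℕ, ∫ t, t ^ n ∂μ = gammaSeq α n

/-- The Mellin transform `∫ t ^ z dμ(t)`, over `t > 0`, of a positive measure on the real line. -/
noncomputable def mellinMeasure (μ : Measure ℝ) (z : ℂ) : ℂ :=
  ∫ t in Ioi (0 : ℝ), (t : ℂ) ^ z ∂μ

/-- The Mellin transform `∫ t ^ z dξ(t)`, over `t > 0`, of a charge on the real line. -/
noncomputable def mellinCharge (ξ : SignedMeasure ℝ) (z : ℂ) : ℂ :=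
  (ξ.restrict (Ioi (0 : ℝ))).integral (fun t : ℝ => (t : ℂ) ^ z)
    (ContinuousLinearMap.lsmul ℝ ℝ (E := ℂ)).flip

/-- The support of a charge, i.e. the support of its total variation measure. -/
noncomputable def chargeSupport (ξ : SignedMeasure ℝ) : Set ℝ := ξ.variation.support

/-- A charge has finite total variation, so that the product of any two charges exists. -/
instance isFiniteMeasure_variation_charge (ξ : SignedMeasure ℝ) : IsFiniteMeasure ξ.variation := by
  rw [← SignedMeasure.totalVariation_eq_variation, SignedMeasure.totalVariation]
  infer_instance

/-- The multiplicative convolution of two charges: the image of the product charge under the map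
`(x, y) ↦ x * y`. -/
noncomputable def mulConv (ξ η : SignedMeasure ℝ) : SignedMeasure ℝ :=
  (VectorMeasure.prod ξ η (ContinuousLinearMap.mul ℝ ℝ)).map (fun p : ℝ × ℝ => p.1 * p.2)

end AluthgeShift

/-!
Write `M` for the Mellin transform of the Berger measure `μ`, an exponential sum
`M z = ∑ a_t t^z` with positive coefficients and `t ≥ 1`.

The Aluthge transform is the weighted shift with weights `√(α n) * √(α (n + 1))`, so its moments
`γ' n` satisfy `γ n * γ (n + 1) = γ 1 * (γ' n) ^ 2` (`gammaSeq_mul_succ`). If it is subnormal, then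
`γ'` is the moment sequence of a measure `ν` on `[0, ∞)`. Since the squares of the moments of `ν`
are the moments of a finitely atomic measure, `ν` is finitely atomic as well
(`exists_finset_ae_mem_of_moment_sq`). An exponential sum is determined by its values on `ℕ`, so
`M z * M (z + 1) = K z ^ 2` for all complex `z`, with an exponential sum `K`
(`exists_expSum_sq_eq`).

Far to the right the largest atom dominates, so there `M` has no zeros and has a holomorphic square
root `h`. The formula `h z = ± K z / h (z + 1)` continues `h` to the left, unit by unit. The
singularities are removable because the square of the continuation is the entire function `M`. This
gives an entire square root (`exists_entire_sqrt`).

Conversely let `H ^ 2 = M` with `H` entire. On a right half-plane `H` is given by the binomial series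
of `√(1 + w)`, where `w` is an exponential sum with negative frequencies. Cutting this series off far
enough, and discarding the negative frequencies, leaves an exponential sum `p` with nonnegative
frequencies such that `H - p` tends to zero on the right. On the left both `H` and `p` are bounded,
so `H = p` by Liouville's theorem (`exists_expSum_eq_of_sq`). The coefficients of `p` are real because
`M > 0` on `ℕ`. Hence `H` is the Mellin transform of a finitely atomic charge, and `p * p = M`
translates into the statement on multiplicative convolution (`mulConv_charge`).
-/

/-! ### Exponential sums -/

namespace ExpSum

open Filter Topology

/-- The exponential sum `z ↦ ∑ c(l) e^(l z)` with finitely many real frequencies `l` and complex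
coefficients `c(l)`, as an algebra homomorphism from the group algebra of `ℝ` to functions on `ℂ`. -/
noncomputable def expSum : AddMonoidAlgebra ℂ ℝ →ₐ[ℂ] (ℂ → ℂ) :=
  AddMonoidAlgebra.lift ℂ (ℂ → ℂ) ℝ
    { toFun := fun l z => Complex.exp ((Multiplicative.toAdd l : ℝ) * z)
      map_one' := by ext z; simp
      map_mul' := fun l m => by
        ext z
        simp [add_mul, Complex.exp_add] }

theorem expSum_apply (f : AddMonoidAlgebra ℂ ℝ) (z : ℂ) :
    expSum f z = ∑ l ∈ f.coeff.support, f.coeff l * Complex.exp (l * z) := by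
  rw [expSum, AddMonoidAlgebra.lift_apply, Finsupp.sum, Finset.sum_apply]
  simp

@[simp]
theorem expSum_single (l : ℝ) (c z : ℂ) :
    expSum (AddMonoidAlgebra.single l c) z = c * Complex.exp (l * z) := by
  rw [expSum, AddMonoidAlgebra.lift_single]
  simp

theorem differentiable_expSum (f : AddMonoidAlgebra ℂ ℝ) : Differentiable ℂ (expSum f) := by
  have : expSum f = fun z => ∑ l ∈ f.coeff.support, f.coeff l * Complex.exp (l * z) :=
    funext (expSum_apply f)
  rw [this]
  fun_prop

theorem norm_exp_real_mul (l : ℝ) (z : ℂ) : ‖Complex.exp (l * z)‖ = Real.exp (l * z.re) := by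
  simp [Complex.norm_exp]

theorem norm_expSum_le (f : AddMonoidAlgebra ℂ ℝ) (z : ℂ) :
    ‖expSum f z‖ ≤ ∑ l ∈ f.coeff.support, ‖f.coeff l‖ * Real.exp (l * z.re) := by
  rw [expSum_apply]
  refine (norm_sum_le _ _).trans (Finset.sum_le_sum fun l _ => ?_)
  rw [norm_mul, norm_exp_real_mul]

theorem exists_bound_of_nonneg (f : AddMonoidAlgebra ℂ ℝ) (hf : ∀ l ∈ f.coeff.support, 0 ≤ l)
    (x : ℝ) : ∃ C : ℝ, ∀ z : ℂ, z.re ≤ x → ‖expSum f z‖ ≤ C := by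
  refine ⟨∑ l ∈ f.coeff.support, ‖f.coeff l‖ * Real.exp (l * x), fun z hz => ?_⟩
  refine (norm_expSum_le f z).trans (Finset.sum_le_sum fun l hl => ?_)
  have := hf l hl
  gcongr

theorem exists_decay_of_neg (f : AddMonoidAlgebra ℂ ℝ) (hf : ∀ l ∈ f.coeff.support, l < 0) :
    ∃ k C : ℝ, 0 < k ∧ 0 ≤ C ∧ ∀ z : ℂ, 0 ≤ z.re → ‖expSum f z‖ ≤ C * Real.exp (-k * z.re) := by
  obtain ⟨k, hk0, hk⟩ : ∃ k : ℝ, 0 < k ∧ ∀ l ∈ f.coeff.support, l ≤ -k := by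
    rcases f.coeff.support.eq_empty_or_nonempty with h | h
    · exact ⟨1, one_pos, by simp [h]⟩
    · refine ⟨-f.coeff.support.max' h, by linarith [hf _ (f.coeff.support.max'_mem h)], ?_⟩
      intro l hl
      simpa using f.coeff.support.le_max' l hl
  refine ⟨k, ∑ l ∈ f.coeff.support, ‖f.coeff l‖, hk0, by positivity, fun z hz => ?_⟩
  refine (norm_expSum_le f z).trans ?_
  rw [Finset.sum_mul]
  refine Finset.sum_le_sum fun l hl => ?_
  have := hk l hl
  gcongr

/-- An exponential sum is determined by its values at the natural numbers, because the characters
`n ↦ e^(l n)` of `ℕ` are linearly independent. -/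
theorem eq_zero_of_forall_nat (f : AddMonoidAlgebra ℂ ℝ) (hf : ∀ n : ℕ, expSum f n = 0) :
    f = 0 := by
  let χ : ℝ → (Multiplicative ℕ →* ℂ) := fun l =>
    { toFun := fun n => Complex.exp (l * (Multiplicative.toAdd n : ℕ))
      map_one' := by simp
      map_mul' := fun a b => by simp [mul_add, Complex.exp_add] }
  have hinj : Function.Injective χ := by
    intro l m h
    have h1 : Complex.exp (l * ((1 : ℕ) : ℂ)) = Complex.exp (m * ((1 : ℕ) : ℂ)) :=
      DFunLike.congr_fun h (Multiplicative.ofAdd 1)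
    simp only [Nat.cast_one, mul_one, ← Complex.ofReal_exp] at h1
    exact Real.exp_injective (Complex.ofReal_injective h1)
  have hli := (linearIndependent_monoidHom (Multiplicative ℕ) ℂ).comp χ hinj
  rw [linearIndependent_iff] at hli
  have h0 : f.coeff = 0 := by
    apply hli
    ext n
    have := hf (Multiplicative.toAdd n)
    rw [expSum_apply] at this
    rw [Finsupp.linearCombination_apply, Finsupp.sum, Finset.sum_apply]
    simpa [χ] using this
  exact AddMonoidAlgebra.coeff_injective (by simpa using h0)

theorem expSum_injective : Function.Injective expSum := by
  intro f g h
  rw [← sub_eq_zero]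
  refine eq_zero_of_forall_nat _ fun n => ?_
  rw [map_sub, h]
  simp

theorem expSum_eq_of_forall_nat {f g : AddMonoidAlgebra ℂ ℝ}
    (h : ∀ n : ℕ, expSum f n = expSum g n) : f = g := by
  rw [← sub_eq_zero]
  refine eq_zero_of_forall_nat _ fun n => ?_
  rw [map_sub, Pi.sub_apply, h, sub_self]

/-- The translate `z ↦ ∑ c(l) e^(l (z + 1))` of an exponential sum is an exponential sum. -/
theorem exists_expSum_translate (f : AddMonoidAlgebra ℂ ℝ) :
    ∃ g : AddMonoidAlgebra ℂ ℝ, ∀ z, expSum g z = expSum f (z + 1) := by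
  refine ⟨∑ l ∈ f.coeff.support, AddMonoidAlgebra.single l (f.coeff l * Complex.exp l),
    fun z => ?_⟩
  rw [map_sum, Finset.sum_apply, expSum_apply]
  refine Finset.sum_congr rfl fun l _ => ?_
  rw [expSum_single, mul_assoc, ← Complex.exp_add]
  ring_nf

/-- Taylor polynomials of `√(1 + u)` at `u = 0`, with the error estimate. -/
theorem exists_polynomial_sqrt (N : ℕ) :
    ∃ (q : Polynomial ℂ) (C r : ℝ), 0 < r ∧ 0 ≤ C ∧
      ∀ u : ℂ, ‖u‖ < r → ‖(1 + u) ^ (1 / 2 : ℂ) - q.eval u‖ ≤ C * ‖u‖ ^ N := by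
  have han : AnalyticAt ℂ (fun u : ℂ => (1 + u) ^ (1 / 2 : ℂ)) 0 := by
    refine AnalyticAt.cpow (by fun_prop) analyticAt_const ?_
    simp
  obtain ⟨p, hp⟩ := han
  have hO := hp.isBigO_sub_partialSum_pow N
  obtain ⟨C, hC0, hC⟩ := hO.exists_nonneg
  rw [Asymptotics.IsBigOWith, Metric.eventually_nhds_iff] at hC
  obtain ⟨r, hr, h⟩ := hC
  refine ⟨∑ i ∈ Finset.range N, Polynomial.C (p.coeff i) * Polynomial.X ^ i, C, r, hr, hC0,
    fun u hu => ?_⟩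
  have := h (y := u) (by simpa using hu)
  simp only [zero_add, norm_pow, norm_norm] at this
  have hq : (∑ i ∈ Finset.range N, Polynomial.C (p.coeff i) * Polynomial.X ^ i).eval u =
      p.partialSum N u := by
    rw [FormalMultilinearSeries.partialSum, Polynomial.eval_finsetSum]
    refine Finset.sum_congr rfl fun i _ => ?_
    rw [Polynomial.eval_mul, Polynomial.eval_C, Polynomial.eval_pow, Polynomial.eval_X,
      FormalMultilinearSeries.apply_eq_pow_smul_coeff, smul_eq_mul, mul_comm]
  rwa [hq]

theorem isPreconnected_re_gt (x : ℝ) : IsPreconnected {z : ℂ | x < z.re} :=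
  (convex_halfSpace_re_gt x).isPreconnected

theorem exists_forall_norm_expSum_lt (w : AddMonoidAlgebra ℂ ℝ)
    (hw : ∀ l ∈ w.coeff.support, l < 0) {r : ℝ} (hr : 0 < r) :
    ∃ x₀ : ℝ, 0 ≤ x₀ ∧ ∀ z : ℂ, x₀ < z.re → ‖expSum w z‖ < r := by
  obtain ⟨k, C, hk, hC0, hC⟩ := exists_decay_of_neg w hw
  have ht : Tendsto (fun x : ℝ => C * Real.exp (-k * x)) atTop (𝓝 0) := by
    have h1 : Tendsto (fun x : ℝ => -k * x) atTop atBot :=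
      tendsto_id.const_mul_atTop_of_neg (by linarith)
    simpa using (Real.tendsto_exp_atBot.comp h1).const_mul C
  obtain ⟨a, ha⟩ := eventually_atTop.1 (ht.eventually_lt_const hr)
  refine ⟨max a 0, le_max_right _ _, fun z hz => ?_⟩
  have h0 : 0 ≤ z.re := (le_max_right a 0).trans hz.le
  exact (hC z h0).trans_lt (ha _ ((le_max_left a 0).trans hz.le))

/-- The square root `B e^(L z / 2) √(1 + w z)` of `B ^ 2 e^(L z) (1 + w z)`, given by the principal
branch. -/
noncomputable def sqrtBranch (B : ℂ) (L : ℝ) (w : AddMonoidAlgebra ℂ ℝ) (z : ℂ) : ℂ :=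
  B * Complex.exp (L / 2 * z) * (1 + expSum w z) ^ (1 / 2 : ℂ)

theorem sqrtBranch_sq (B : ℂ) (L : ℝ) (w : AddMonoidAlgebra ℂ ℝ) (z : ℂ) :
    sqrtBranch B L w z ^ 2 = B ^ 2 * Complex.exp (L * z) * (1 + expSum w z) := by
  have h1 : ((1 + expSum w z) ^ (1 / 2 : ℂ)) ^ 2 = 1 + expSum w z := by
    rw [← Complex.cpow_nat_mul]; simp
  have h2 : Complex.exp (L / 2 * z) ^ 2 = Complex.exp (L * z) := by
    rw [← Complex.exp_nat_mul]; congr 1; push_cast; ring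
  simp only [sqrtBranch, mul_pow, h1, h2]

theorem analyticAt_sqrtBranch (B : ℂ) (L : ℝ) {w : AddMonoidAlgebra ℂ ℝ} {z : ℂ}
    (hz : ‖expSum w z‖ < 1) : AnalyticAt ℂ (sqrtBranch B L w) z := by
  have hw : AnalyticAt ℂ (expSum w) z := (differentiable_expSum w).analyticAt z
  exact AnalyticAt.mul (by fun_prop) ((analyticAt_const.add hw).cpow analyticAt_const
    (Complex.mem_slitPlane_of_norm_lt_one hz))

theorem sqrtBranch_ne_zero {B : ℂ} (hB : B ≠ 0) (L : ℝ) {w : AddMonoidAlgebra ℂ ℝ} {z : ℂ}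
    (hz : ‖expSum w z‖ < 1) : sqrtBranch B L w z ≠ 0 := by
  refine mul_ne_zero (mul_ne_zero hB (Complex.exp_ne_zero _)) ?_
  rw [Complex.cpow_def_of_ne_zero
    (Complex.slitPlane_ne_zero (Complex.mem_slitPlane_of_norm_lt_one hz))]
  exact Complex.exp_ne_zero _

/-- An entire function that is bounded on left half-planes, and whose square is an exponential sum
with dominant term `B ^ 2 e^(L z)`, is itself an exponential sum with nonnegative frequencies.

Near `re z = +∞` the function is `± B e^(L z / 2) √(1 + w)`, so truncated Taylor expansion writes it
as an exponential sum plus an error tending to zero. Moving the negative frequencies into the error,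
the error becomes an entire function that is bounded, on left half-planes because both terms are,
and on a right half-plane because it tends to zero. By Liouville's theorem it vanishes. -/
theorem exists_expSum_eq_of_sq {H : ℂ → ℂ} (hH : Differentiable ℂ H) (B : ℂ) (hB : B ≠ 0) (L : ℝ)
    (w : AddMonoidAlgebra ℂ ℝ) (hw : ∀ l ∈ w.coeff.support, l < 0)
    (hsq : ∀ z, H z ^ 2 = B ^ 2 * Complex.exp (L * z) * (1 + expSum w z))
    (hbd : ∀ x : ℝ, ∃ C : ℝ, ∀ z : ℂ, z.re ≤ x → ‖H z‖ ^ 2 ≤ C) :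
    ∃ p : AddMonoidAlgebra ℂ ℝ, (∀ l ∈ p.coeff.support, 0 ≤ l) ∧ ∀ z, expSum p z = H z := by
  obtain ⟨k, C, hk, hC0, hC⟩ := exists_decay_of_neg w hw
  obtain ⟨N, hN⟩ := exists_nat_gt (L / 2 / k)
  have hN' : L / 2 - k * N < 0 := by
    rw [div_lt_iff₀ hk] at hN; linarith
  obtain ⟨q, D, r, hr, hD0, hD⟩ := exists_polynomial_sqrt N
  -- to the right of `x₀` the perturbation `w` is smaller than `1` and `r`
  obtain ⟨x₀, hx₀, hx₀'⟩ := exists_forall_norm_expSum_lt w hw (lt_min one_pos hr)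
  set U : Set ℂ := {z | x₀ < z.re} with hU
  have hw1 : ∀ z ∈ U, ‖expSum w z‖ < 1 := fun z hz => (hx₀' z hz).trans_le (min_le_left _ _)
  set h : ℂ → ℂ := sqrtBranch B L w with hh
  have hne : ∀ z ∈ U, h z ≠ 0 := fun z hz => sqrtBranch_ne_zero hB L (hw1 z hz)
  have hcont : ContinuousOn h U := fun z hz =>
    (analyticAt_sqrtBranch B L (hw1 z hz)).continuousAt.continuousWithinAt
  have hhsq : ∀ z, h z ^ 2 = B ^ 2 * Complex.exp (L * z) * (1 + expSum w z) :=
    sqrtBranch_sq B L w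
  obtain ⟨ε, hε, hHε⟩ : ∃ ε : ℂ, ‖ε‖ = 1 ∧ ∀ z ∈ U, H z = ε * h z := by
    rcases (isPreconnected_re_gt x₀).eq_or_eq_neg_of_sq_eq hH.continuous.continuousOn hcont
      (fun z _ => by simp only [Pi.pow_apply, hsq, hhsq]) (fun {z} hz => hne z hz) with h1 | h1
    · exact ⟨1, by simp, fun z hz => by rw [h1 hz, one_mul]⟩
    · exact ⟨-1, by simp, fun z hz => by rw [h1 hz]; simp⟩
  set p₀ : AddMonoidAlgebra ℂ ℝ :=
    AddMonoidAlgebra.single (L / 2) (ε * B) * Polynomial.aeval w q with hp₀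
  have hp₀_apply : ∀ z, expSum p₀ z = ε * B * Complex.exp (L / 2 * z) * q.eval (expSum w z) := by
    intro z
    have h1 : (Polynomial.aeval (expSum w) q) z = q.eval (expSum w z) := by
      simp
    rw [hp₀, map_mul, Pi.mul_apply, ← Polynomial.aeval_algHom_apply, h1, expSum_single]
    push_cast
    ring
  set p₁ : AddMonoidAlgebra ℂ ℝ := .ofCoeff (p₀.coeff.filter (0 ≤ ·)) with hp₁
  set p₂ : AddMonoidAlgebra ℂ ℝ := .ofCoeff (p₀.coeff.filter (¬ 0 ≤ ·)) with hp₂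
  have hp : p₁ + p₂ = p₀ := by
    apply AddMonoidAlgebra.coeff_injective
    simp only [hp₁, hp₂, AddMonoidAlgebra.coeff_add]
    exact Finsupp.filter_add_filter_not _ _
  have hp₁s : ∀ l ∈ p₁.coeff.support, 0 ≤ l := by
    intro l hl
    simp only [hp₁, Finsupp.support_filter, Finset.mem_filter] at hl
    exact hl.2
  have hp₂s : ∀ l ∈ p₂.coeff.support, l < 0 := by
    intro l hl
    simp only [hp₂, Finsupp.support_filter, Finset.mem_filter] at hl
    exact not_le.1 hl.2
  obtain ⟨k₂, C₂, hk₂, hC₂0, hC₂⟩ := exists_decay_of_neg p₂ hp₂s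
  refine ⟨p₁, hp₁s, ?_⟩
  set G : ℂ → ℂ := fun z => H z - expSum p₁ z with hG
  -- the decay of the error on the right half-plane
  have hright : ∀ z ∈ U, ‖G z‖ ≤ ‖B‖ * D * C ^ N * Real.exp ((L / 2 - k * N) * z.re) +
      C₂ * Real.exp (-k₂ * z.re) := by
    intro z hz
    have hz0 : 0 ≤ z.re := hx₀.trans (le_of_lt hz)
    have h1 : G z = ε * B * Complex.exp (L / 2 * z) *
        ((1 + expSum w z) ^ (1 / 2 : ℂ) - q.eval (expSum w z)) + expSum p₂ z := by
      have h2 : expSum p₁ z = expSum p₀ z - expSum p₂ z := by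
        rw [← hp, map_add, Pi.add_apply]; ring
      simp only [hG, h2, hp₀_apply, hHε z hz, hh, sqrtBranch]
      ring
    rw [h1]
    refine (norm_add_le _ _).trans (add_le_add ?_ (hC₂ z hz0))
    have h3 : ‖Complex.exp (L / 2 * z)‖ = Real.exp (L / 2 * z.re) := by
      rw [← norm_exp_real_mul]; push_cast; rfl
    rw [norm_mul, norm_mul, norm_mul, hε, h3, one_mul]
    have h4 := hD _ ((hx₀' z hz).trans_le (min_le_right _ _))
    have h5 : ‖expSum w z‖ ^ N ≤ C ^ N * Real.exp (-k * z.re) ^ N := by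
      rw [← mul_pow]; exact pow_le_pow_left₀ (norm_nonneg _) (hC z hz0) N
    calc _ ≤ ‖B‖ * Real.exp (L / 2 * z.re) * (D * (C ^ N * Real.exp (-k * z.re) ^ N)) := by
          gcongr
          exact h4.trans (by gcongr)
      _ = _ := by
          rw [← Real.exp_nat_mul, show (L / 2 - k * N) * z.re = L / 2 * z.re + N * (-k * z.re) by
            ring, Real.exp_add]
          ring
  have hGd : Differentiable ℂ G := hH.sub (differentiable_expSum p₁)
  have hGb : Bornology.IsBounded (range G) := by
    obtain ⟨C₃, hC₃⟩ := hbd x₀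
    obtain ⟨C₄, hC₄⟩ := exists_bound_of_nonneg p₁ hp₁s x₀
    rw [isBounded_iff_forall_norm_le]
    refine ⟨max (Real.sqrt C₃ + C₄) (‖B‖ * D * C ^ N + C₂), ?_⟩
    rintro _ ⟨z, rfl⟩
    rcases le_or_gt z.re x₀ with hz | hz
    · refine le_max_of_le_left ((norm_sub_le _ _).trans (add_le_add ?_ (hC₄ z hz)))
      exact Real.le_sqrt_of_sq_le (hC₃ z hz)
    · have hz0 : 0 ≤ z.re := hx₀.trans hz.le
      refine le_max_of_le_right ((hright z hz).trans ?_)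
      have e1 : Real.exp ((L / 2 - k * N) * z.re) ≤ 1 :=
        Real.exp_le_one_iff.2 (mul_nonpos_of_nonpos_of_nonneg hN'.le hz0)
      have e2 : Real.exp (-k₂ * z.re) ≤ 1 :=
        Real.exp_le_one_iff.2 (mul_nonpos_of_nonpos_of_nonneg (by linarith) hz0)
      refine add_le_add (mul_le_of_le_one_right (by positivity) e1)
        (mul_le_of_le_one_right hC₂0 e2)
  have hlim : Tendsto (fun x : ℝ => G x) atTop (𝓝 0) := by
    have ht : ∀ c : ℝ, c < 0 → Tendsto (fun x : ℝ => Real.exp (c * x)) atTop (𝓝 0) := fun c hc =>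
      Real.tendsto_exp_atBot.comp (tendsto_id.const_mul_atTop_of_neg hc)
    have hb := ((ht _ hN').const_mul (‖B‖ * D * C ^ N)).add ((ht (-k₂) (by linarith)).const_mul C₂)
    rw [mul_zero, mul_zero, add_zero] at hb
    refine squeeze_zero_norm' ?_ hb
    filter_upwards [eventually_gt_atTop x₀] with x hx
    simpa using hright (x : ℂ) (by simpa [hU] using hx)
  intro z
  have hconst : ∀ x : ℝ, G x = G z := fun x => hGd.apply_eq_apply_of_bounded hGb _ _
  have : G z = 0 := by
    simp only [hconst] at hlim
    exact tendsto_nhds_unique tendsto_const_nhds hlim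
  simp only [hG] at this
  exact (sub_eq_zero.1 this).symm

end ExpSum

/-! ### Entire square roots -/

namespace EntireSqrt

open Filter Topology

/-- The open right half-plane `x < re z`. -/
def halfPlane (x : ℝ) : Set ℂ := {z | x < z.re}

@[simp]
theorem mem_halfPlane {x : ℝ} {z : ℂ} : z ∈ halfPlane x ↔ x < z.re := Iff.rfl

theorem isOpen_halfPlane (x : ℝ) : IsOpen (halfPlane x) :=
  isOpen_lt continuous_const Complex.continuous_re

theorem isPreconnected_halfPlane (x : ℝ) : IsPreconnected (halfPlane x) :=
  ExpSum.isPreconnected_re_gt x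

/-- A meromorphic function whose square extends analytically can be corrected on a discrete set to
an analytic function with the same square. -/
theorem exists_analyticOnNhd_sq_eq {q F : ℂ → ℂ} {U : Set ℂ} (hq : MeromorphicOn q U)
    (hF : AnalyticOnNhd ℂ F U) (hqF : ∀ z ∈ U, ∀ᶠ y in 𝓝[≠] z, q y ^ 2 = F y) :
    ∃ g : ℂ → ℂ, AnalyticOnNhd ℂ g U ∧ ∀ z ∈ U, g z ^ 2 = F z := by
  set g := toMeromorphicNFOn q U with hg
  have hgF : ∀ z ∈ U, ∀ᶠ y in 𝓝[≠] z, g y ^ 2 = F y := fun z hz => by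
    filter_upwards [hqF z hz, hq.toMeromorphicNFOn_eq_self_on_nhdsNE hz] with y h1 h2
    rw [hg, h2, h1]
  have hgan : AnalyticOnNhd ℂ g U := fun z hz => by
    have hnf : MeromorphicNFAt g z := meromorphicNFOn_toMeromorphicNFOn q U hz
    rw [← hnf.meromorphicOrderAt_nonneg_iff_analyticAt]
    have h1 : 0 ≤ meromorphicOrderAt (g ^ 2) z := by
      have h2 : g ^ 2 =ᶠ[𝓝[≠] z] F := hgF z hz
      rw [meromorphicOrderAt_congr h2]
      exact (hF z hz).meromorphicOrderAt_nonneg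
    rw [meromorphicOrderAt_pow hnf.meromorphicAt] at h1
    rcases eq_or_ne (meromorphicOrderAt g z) ⊤ with h | h
    · simp [h]
    · lift meromorphicOrderAt g z to ℤ using h with n
      have h2 : (0 : WithTop ℤ) ≤ ((2 * n : ℤ) : WithTop ℤ) := by simpa using h1
      have h3 : 0 ≤ 2 * n := by exact_mod_cast h2
      have : 0 ≤ n := by omega
      exact_mod_cast this
  refine ⟨g, hgan, fun z hz => ?_⟩
  have h1 : (fun y => g y ^ 2) =ᶠ[𝓝[≠] z] F := hgF z hz
  have h2 : ContinuousAt (fun y => g y ^ 2) z := (hgan z hz).continuousAt.pow 2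
  exact ((h2.eventuallyEq_nhds_iff_eventuallyEq_nhdsNE (hF z hz).continuousAt).1 h1).eq_of_nhds

/-- The functional equation `F z * F (z + 1) = K z ^ 2` continues a square root of `F` from a right
half-plane to the half-plane that is larger by one unit, as `K z / g (z + 1)`. -/
theorem exists_sqrt_halfPlane_sub_one {F K : ℂ → ℂ} (hF : Differentiable ℂ F)
    (hK : Differentiable ℂ K) (hF0 : ∃ z, F z ≠ 0) (hFK : ∀ z, F z * F (z + 1) = K z ^ 2) {x : ℝ}
    {g : ℂ → ℂ} (hg : AnalyticOnNhd ℂ g (halfPlane x)) (hgF : ∀ z ∈ halfPlane x, g z ^ 2 = F z) :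
    ∃ g' : ℂ → ℂ, AnalyticOnNhd ℂ g' (halfPlane (x - 1)) ∧
      ∀ z ∈ halfPlane (x - 1), g' z ^ 2 = F z := by
  have hFan : AnalyticOnNhd ℂ F univ := hF.differentiableOn.analyticOnNhd isOpen_univ
  have hmem : ∀ z ∈ halfPlane (x - 1), z + 1 ∈ halfPlane x := fun z hz => by
    simp only [mem_halfPlane, Complex.add_re, Complex.one_re] at hz ⊢
    linarith
  have hshift : ∀ z : ℂ, AnalyticAt ℂ (fun y : ℂ => y + 1) z := fun z => by fun_prop
  refine exists_analyticOnNhd_sq_eq (q := fun z => K z / g (z + 1)) ?_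
    (hFan.mono (subset_univ _)) ?_
  · intro z hz
    refine (hK.analyticAt z).meromorphicAt.div (AnalyticAt.meromorphicAt ?_)
    exact (hg _ (hmem z hz)).comp (f := fun y : ℂ => y + 1) (hshift z)
  · intro z hz
    have hne : ∀ᶠ y in 𝓝[≠] z, F (y + 1) ≠ 0 := by
      have han : AnalyticOnNhd ℂ (fun y => F (y + 1)) univ := fun y _ =>
        (hFan (y + 1) (mem_univ _)).comp (f := fun y : ℂ => y + 1) (hshift y)
      rcases (han z (mem_univ _)).eventually_eq_zero_or_eventually_ne_zero with h | h
      · obtain ⟨y, hy⟩ := hF0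
        have := han.eqOn_zero_of_preconnected_of_eventuallyEq_zero isPreconnected_univ
          (mem_univ z) h (mem_univ (y - 1))
        exact absurd (by simpa using this) hy
      · exact h
    have hU : ∀ᶠ y in 𝓝[≠] z, y ∈ halfPlane (x - 1) :=
      eventually_nhdsWithin_of_eventually_nhds ((isOpen_halfPlane _).mem_nhds hz)
    filter_upwards [hne, hU] with y h1 h2
    rw [div_pow, hgF _ (hmem y h2), ← hFK, mul_div_cancel_right₀ _ h1]

/-- An entire function `F` for which `F z * F (z + 1)` is the square of an entire function has an
entire square root, provided it has a square root without zeros on some right half-plane. -/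
theorem exists_entire_sqrt {F K h : ℂ → ℂ} (hF : Differentiable ℂ F) (hK : Differentiable ℂ K)
    (hFK : ∀ z, F z * F (z + 1) = K z ^ 2) {x : ℝ} (hh : AnalyticOnNhd ℂ h (halfPlane x))
    (hhF : ∀ z ∈ halfPlane x, h z ^ 2 = F z) (hh0 : ∀ z ∈ halfPlane x, h z ≠ 0) :
    ∃ H : ℂ → ℂ, Differentiable ℂ H ∧ ∀ z, H z ^ 2 = F z := by
  have hz₀ : ((x + 1 : ℝ) : ℂ) ∈ halfPlane x := by simp [halfPlane]
  have hF0 : ∃ z, F z ≠ 0 := ⟨_, by rw [← hhF _ hz₀]; exact pow_ne_zero 2 (hh0 _ hz₀)⟩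
  have hsub : ∀ n : ℕ, halfPlane x ⊆ halfPlane (x - n) := fun n z hz => by
    simp only [mem_halfPlane] at hz ⊢
    have : (0 : ℝ) ≤ n := n.cast_nonneg
    linarith
  have hex : ∀ n : ℕ, ∃ g : ℂ → ℂ, AnalyticOnNhd ℂ g (halfPlane (x - n)) ∧
      ∀ z ∈ halfPlane (x - n), g z ^ 2 = F z := by
    intro n
    induction n with
    | zero => exact ⟨h, by simpa using hh, by simpa using hhF⟩
    | succ n ih =>
      obtain ⟨g, hg, hgF⟩ := ih
      rw [show x - ((n + 1 : ℕ) : ℝ) = x - n - 1 by push_cast; ring]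
      exact exists_sqrt_halfPlane_sub_one hF hK hF0 hFK hg hgF
  -- the sign of each extension is normalised by comparison with `h`
  have hex' : ∀ n : ℕ, ∃ g : ℂ → ℂ, AnalyticOnNhd ℂ g (halfPlane (x - n)) ∧
      (∀ z ∈ halfPlane (x - n), g z ^ 2 = F z) ∧ EqOn g h (halfPlane x) := by
    intro n
    obtain ⟨g, hg, hgF⟩ := hex n
    rcases (isPreconnected_halfPlane x).eq_or_eq_neg_of_sq_eq
      (hg.continuousOn.mono (hsub n)) hh.continuousOn
      (fun z hz => by simp only [Pi.pow_apply, hgF z (hsub n hz), hhF z hz])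
      (fun {z} hz => hh0 z hz) with h1 | h1
    · exact ⟨g, hg, hgF, h1⟩
    · refine ⟨-g, hg.neg, fun z hz => by simp [hgF z hz], fun z hz => ?_⟩
      simp [h1 hz]
  choose g hg hgF hgh using hex'
  have hagree : ∀ m n : ℕ, m ≤ n → EqOn (g n) (g m) (halfPlane (x - m)) := by
    intro m n hmn
    have hmono : halfPlane (x - m) ⊆ halfPlane (x - n) := fun z hz => by
      simp only [mem_halfPlane] at hz ⊢
      have : (m : ℝ) ≤ n := by exact_mod_cast hmn
      linarith
    refine ((hg n).mono hmono).eqOn_of_preconnected_of_eventuallyEq (hg m)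
      (isPreconnected_halfPlane _) (hsub m hz₀) ?_
    filter_upwards [(isOpen_halfPlane x).mem_nhds hz₀] with z hz
    rw [hgh n hz, hgh m hz]
  have hN : ∀ z : ℂ, ∃ n : ℕ, z ∈ halfPlane (x - n) := fun z => by
    obtain ⟨n, hn⟩ := exists_nat_gt (x - z.re)
    exact ⟨n, by simp only [mem_halfPlane]; linarith⟩
  choose N hN using hN
  have hH : ∀ n : ℕ, ∀ z ∈ halfPlane (x - n), g (N z) z = g n z := by
    intro n z hz
    rcases le_total n (N z) with hle | hle
    · exact hagree _ _ hle hz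
    · exact (hagree _ _ hle (hN z)).symm
  refine ⟨fun z => g (N z) z, fun z => ?_, fun z => hgF _ z (hN z)⟩
  refine DifferentiableAt.congr_of_eventuallyEq (hg (N z) z (hN z)).differentiableAt ?_
  filter_upwards [(isOpen_halfPlane _).mem_nhds (hN z)] with y hy
  exact hH _ y hy

end EntireSqrt

/-! ### The Aluthge transform of a weighted shift -/

namespace AluthgeShift

theorem norm_e (n : ℕ) : ‖e n‖ = 1 := by
  rw [e, lp.norm_single (by norm_num)]
  simp

theorem inner_e_left (i : ℕ) (x : Seq2) : inner ℂ (e i) x = x i := by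
  rw [e, lp.inner_single_left]
  simp

theorem e_apply (i j : ℕ) : (e j : ℕ → ℂ) i = if i = j then 1 else 0 := by
  rw [e, lp.single_apply]
  by_cases h : i = j
  · subst h; simp
  · simp [h]

variable {H : Type*} [NormedAddCommGroup H] [InnerProductSpace ℂ H] [CompleteSpace H]

omit [CompleteSpace H] in
/-- An eigenvector of `A ^ 2` with eigenvalue `a ^ 2`, `a > 0`, is an eigenvector of the positive
operator `A` with eigenvalue `a`, because `A + a` is injective. -/
theorem apply_eq_smul_of_sq {A : H →L[ℂ] H} (hA : 0 ≤ A) {a : ℝ} (ha : 0 < a) {v : H}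
    (hv : A (A v) = ((a ^ 2 : ℝ) : ℂ) • v) : A v = (a : ℂ) • v := by
  have hpos := (ContinuousLinearMap.nonneg_iff_isPositive A).1 hA
  set y : H := A v - (a : ℂ) • v with hy
  have h1 : A y + (a : ℂ) • y = 0 := by
    rw [hy, map_sub, map_smul, hv, smul_sub, smul_smul]
    push_cast
    rw [sq]
    abel
  have h2 : (inner ℂ (A y) y).re + a * ‖y‖ ^ 2 = 0 := by
    have h3 : inner ℂ (A y + (a : ℂ) • y) y = 0 := by rw [h1, inner_zero_left]
    rw [inner_add_left, inner_smul_left, inner_self_eq_norm_sq_to_K] at h3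
    have h4 := congrArg Complex.re h3
    simpa [← Complex.ofReal_pow] using h4
  have h5 : 0 ≤ (inner ℂ (A y) y).re := hpos.re_inner_nonneg_left y
  have h6 : ‖y‖ ^ 2 = 0 := by
    have := sq_nonneg ‖y‖
    by_contra hne
    have : 0 < ‖y‖ ^ 2 := lt_of_le_of_ne this (Ne.symm hne)
    have := mul_pos ha this
    linarith
  have : y = 0 := by simpa using h6
  exact sub_eq_zero.1 this

theorem abs_apply_eq_smul {T : H →L[ℂ] H} {a : ℝ} (ha : 0 < a) {v : H}
    (hv : (star T * T) v = ((a ^ 2 : ℝ) : ℂ) • v) : CFC.abs T v = (a : ℂ) • v := by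
  refine apply_eq_smul_of_sq (CFC.abs_nonneg T) ha ?_
  rw [← hv, ← CFC.abs_mul_abs]
  rfl

theorem sqrt_abs_apply_eq_smul {T : H →L[ℂ] H} {a : ℝ} (ha : 0 < a) {v : H}
    (hv : (star T * T) v = ((a ^ 2 : ℝ) : ℂ) • v) :
    CFC.sqrt (CFC.abs T) v = (Real.sqrt a : ℂ) • v := by
  have hsq : CFC.sqrt (CFC.abs T) * CFC.sqrt (CFC.abs T) = CFC.abs T :=
    CFC.sqrt_mul_sqrt_self _ (CFC.abs_nonneg T)
  have h0 : 0 ≤ CFC.sqrt (CFC.abs T) := CFC.sqrt_nonneg (CFC.abs T)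
  refine apply_eq_smul_of_sq h0 (Real.sqrt_pos.2 ha) ?_
  rw [Real.sq_sqrt ha.le, ← abs_apply_eq_smul ha hv]
  exact congrArg (fun R : H →L[ℂ] H => R v) hsq

theorem IsAluthgeTransform.apply_eq_smul {T S : H →L[ℂ] H} (hS : IsAluthgeTransform T S) {a b : ℝ}
    (ha : 0 < a) (hb : 0 < b) {v w : H} (hv : (star T * T) v = ((a ^ 2 : ℝ) : ℂ) • v)
    (hw : (star T * T) w = ((b ^ 2 : ℝ) : ℂ) • w) (hvw : T v = (a : ℂ) • w) :
    S v = (Real.sqrt a * Real.sqrt b : ℂ) • w := by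
  obtain ⟨V, hV, rfl⟩ := hS
  have hVv : V v = w := by
    have h1 : T v = V (CFC.abs T v) := congrArg (fun R : H →L[ℂ] H => R v) hV.eq_mul_abs
    rw [abs_apply_eq_smul ha hv, hvw, map_smul] at h1
    have h2 : (a : ℂ) ≠ 0 := by exact_mod_cast ha.ne'
    exact (smul_right_injective _ h2 h1).symm
  have : (CFC.sqrt (CFC.abs T) * V * CFC.sqrt (CFC.abs T)) v =
      CFC.sqrt (CFC.abs T) (V (CFC.sqrt (CFC.abs T) v)) := rfl
  rw [this, sqrt_abs_apply_eq_smul ha hv, map_smul, hVv, map_smul, sqrt_abs_apply_eq_smul hb hw,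
    smul_smul]

variable {α : ℕ → ℝ} {W S : Seq2 →L[ℂ] Seq2}

theorem IsWeightedShift.star_mul_self_apply (hW : IsWeightedShift α W) (n : ℕ) :
    (star W * W) (e n) = ((α n ^ 2 : ℝ) : ℂ) • e n := by
  ext i
  rw [← inner_e_left]
  have : (star W * W) (e n) = ContinuousLinearMap.adjoint W (W (e n)) := rfl
  rw [this, ContinuousLinearMap.adjoint_inner_right, hW.map_basis, hW.map_basis, inner_smul_left,
    inner_smul_right, inner_e_left]
  simp only [lp.coeFn_smul, Pi.smul_apply, e_apply, Complex.conj_ofReal]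
  by_cases h : i = n
  · subst h; simp; ring
  · simp [h]

/-- The Aluthge transform of the weighted shift with weights `α` is the weighted shift with weights
`√(α n) * √(α (n + 1))`. -/
theorem IsWeightedShift.aluthge (hW : IsWeightedShift α W) (hS : IsAluthgeTransform W S) :
    IsWeightedShift (fun n => Real.sqrt (α n) * Real.sqrt (α (n + 1))) S :=
  ⟨fun n => mul_pos (Real.sqrt_pos.2 (hW.weight_pos _)) (Real.sqrt_pos.2 (hW.weight_pos _)),
    fun n => by
      rw [hS.apply_eq_smul (hW.weight_pos n) (hW.weight_pos (n + 1)) (hW.star_mul_self_apply n)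
        (hW.star_mul_self_apply (n + 1)) (hW.map_basis n)]
      push_cast
      rfl⟩

theorem IsWeightedShift.pow_apply (hW : IsWeightedShift α W) (n : ℕ) :
    (W ^ n) (e 0) = ((∏ k ∈ Finset.range n, α k : ℝ) : ℂ) • e n := by
  induction n with
  | zero => simp
  | succ n ih =>
    have : (W ^ (n + 1)) (e 0) = W ((W ^ n) (e 0)) := by rw [pow_succ']; rfl
    rw [this, ih, map_smul, hW.map_basis, smul_smul, Finset.prod_range_succ]
    push_cast
    rfl

theorem IsWeightedShift.norm_sq_pow_apply (hW : IsWeightedShift α W) (n : ℕ) :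
    ‖(W ^ n) (e 0)‖ ^ 2 = gammaSeq α n := by
  rw [hW.pow_apply, norm_smul, norm_e, mul_one, Complex.norm_real, Real.norm_eq_abs, sq_abs,
    ← Finset.prod_pow, gammaSeq]

theorem gammaSeq_mul_succ (hα : ∀ n, 0 < α n) (n : ℕ) :
    gammaSeq α n * gammaSeq α (n + 1) = gammaSeq α 1 *
      gammaSeq (fun n => Real.sqrt (α n) * Real.sqrt (α (n + 1))) n ^ 2 := by
  have h : gammaSeq (fun n => Real.sqrt (α n) * Real.sqrt (α (n + 1))) n =
      ∏ k ∈ Finset.range n, α k * α (k + 1) := by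
    refine Finset.prod_congr rfl fun k _ => ?_
    rw [mul_pow, Real.sq_sqrt (hα _).le, Real.sq_sqrt (hα _).le]
  rw [h, Finset.prod_mul_distrib]
  simp only [gammaSeq, Finset.prod_range_succ' (fun k => α k ^ 2) n, Finset.prod_pow,
    Finset.prod_range_one]
  ring

/-! ### Moments of subnormal operators -/

/-- The spectral measure of a positive operator `A` at a vector `x`, given by its moments. -/
theorem exists_measure_moment {A : H →L[ℂ] H} (hA : 0 ≤ A) (x : H) :
    ∃ ν : Measure ℝ, IsFiniteMeasure ν ∧ (∀ᵐ t ∂ν, 0 ≤ t) ∧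
      (∀ n : ℕ, Integrable (fun t : ℝ => t ^ n) ν) ∧
      ∀ n : ℕ, ∫ t, t ^ n ∂ν = (inner ℂ ((A ^ n) x) x).re := by
  have hsa : IsSelfAdjoint A := .of_nonneg hA
  let Φ := cfcHom (R := ℝ) hsa
  let Λ : CompactlySupportedContinuousMap (spectrum ℝ A) ℝ →ₚ[ℝ] ℝ := PositiveLinearMap.mk₀
    { toFun := fun f => (inner ℂ (Φ f.toContinuousMap x) x).re
      map_add' := fun f g => by
        have : (f + g).toContinuousMap = f.toContinuousMap + g.toContinuousMap := rfl
        rw [this, map_add, add_apply, inner_add_left, Complex.add_re]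
      map_smul' := fun c f => by
        have : (c • f).toContinuousMap = c • f.toContinuousMap := rfl
        rw [this, map_smul, smul_apply, ← Complex.coe_smul, inner_smul_left]
        simp }
    (fun f hf => by
      have h1 : (0 : C(spectrum ℝ A, ℝ)) ≤ f.toContinuousMap := fun t => hf t
      have h2 : 0 ≤ Φ f.toContinuousMap := (cfcHom_nonneg_iff hsa).2 h1
      exact ((ContinuousLinearMap.nonneg_iff_isPositive _).1 h2).re_inner_nonneg_left x)
  have hmeas : MeasurableEmbedding (Subtype.val : spectrum ℝ A → ℝ) :=
    .subtype_coe (spectrum.isClosed A).measurableSet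
  let ρ := RealRMK.rieszMeasure Λ
  have hρ : IsFiniteMeasure ρ := inferInstance
  refine ⟨ρ.map Subtype.val, inferInstance, ?_, fun n => ?_, fun n => ?_⟩
  · rw [hmeas.ae_map_iff]
    exact .of_forall fun t => spectrum_nonneg_of_nonneg hA t.2
  · rw [hmeas.integrable_map_iff]
    have : Continuous ((fun t : ℝ => t ^ n) ∘ (Subtype.val : spectrum ℝ A → ℝ)) := by fun_prop
    exact this.integrable_of_hasCompactSupport (HasCompactSupport.of_compactSpace _)
  · rw [hmeas.integral_map]
    let f : CompactlySupportedContinuousMap (spectrum ℝ A) ℝ :=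
      CompactlySupportedContinuousMap.continuousMapEquiv
        (((ContinuousMap.id ℝ).restrict (spectrum ℝ A)) ^ n)
    have h1 := RealRMK.integral_rieszMeasure Λ f
    have h2 : Λ f = (inner ℂ ((A ^ n) x) x).re := by
      change (inner ℂ (Φ (((ContinuousMap.id ℝ).restrict (spectrum ℝ A)) ^ n) x) x).re = _
      rw [map_pow, cfcHom_id hsa]
    rw [← h2, ← h1]
    rfl

theorem IsSubnormal.exists_measure_moment {T : Seq2 →L[ℂ] Seq2} (hT : IsSubnormal T) (x : Seq2) :
    ∃ ν : Measure ℝ, IsFiniteMeasure ν ∧ (∀ᵐ t ∂ν, 0 ≤ t) ∧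
      (∀ n : ℕ, Integrable (fun t : ℝ => t ^ n) ν) ∧
      ∀ n : ℕ, ∫ t, t ^ n ∂ν = ‖(T ^ n) x‖ ^ 2 := by
  obtain ⟨K, _, _, _, N, J, hN, hJ⟩ := hT
  obtain ⟨ν, h1, h2, h3, h4⟩ := AluthgeShift.exists_measure_moment (star_mul_self_nonneg N) (J x)
  refine ⟨ν, h1, h2, h3, fun n => ?_⟩
  have hpow : (N ^ n) (J x) = J ((T ^ n) x) := by
    induction n with
    | zero => rfl
    | succ n ih =>
      have e1 : (N ^ (n + 1)) (J x) = N ((N ^ n) (J x)) := by rw [pow_succ']; rfl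
      have e2 : (T ^ (n + 1)) x = T ((T ^ n) x) := by rw [pow_succ']; rfl
      rw [e1, e2, ih, hJ]
  have hN' : ((star N * N) ^ n) (J x) = ContinuousLinearMap.adjoint (N ^ n) ((N ^ n) (J x)) := by
    rw [hN.star_comm_self.mul_pow, ← star_pow]
    rfl
  rw [h4, hN', ContinuousLinearMap.adjoint_inner_left, hpow, inner_self_eq_norm_sq_to_K,
    LinearIsometry.norm_map]
  simp [← Complex.ofReal_pow]

end AluthgeShift

/-! ### Finitely atomic measures -/

namespace AluthgeShift

open ExpSum

theorem integral_eq_sum_of_ae_mem {E : Type*} [NormedAddCommGroup E] [NormedSpace ℝ E]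
    [CompleteSpace E] {ν : Measure ℝ} [IsFiniteMeasure ν] {s : Finset ℝ} (hs : ∀ᵐ t ∂ν, t ∈ s)
    (f : ℝ → E) : ∫ t, f t ∂ν = ∑ t ∈ s, ν.real {t} • f t := by
  rw [← setIntegral_finset s IntegrableOn.finset, Measure.restrict_eq_self_of_ae_mem]
  exact hs

theorem measureReal_singleton_pos {μ : Measure ℝ} [IsFiniteMeasure μ] (hμ : μ.support.Finite)
    {t : ℝ} (ht : t ∈ μ.support) : 0 < μ.real {t} := by
  refine lt_of_le_of_ne measureReal_nonneg fun h => ?_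
  have h0 : μ {t} = 0 := by
    rwa [eq_comm, measureReal_eq_zero_iff] at h
  have h1 : μ.support \ {t} ∈ ae μ :=
    Filter.inter_mem Measure.support_mem_ae (compl_mem_ae_iff.2 h0 : ({t} : Set ℝ)ᶜ ∈ ae μ)
  exact (Measure.support_subset_of_isClosed (hμ.subset sdiff_subset).isClosed h1 ht).2 rfl

/-- If the square of the moment sequence of `ν` is, up to a factor, the moment sequence of a finite
combination of point masses, then `ν` is finitely atomic.

If `P` is the square of a polynomial vanishing at those points, then `P (x y)` has integral zero
against `ν × ν`. So for some `x` it vanishes for `ν`-almost every `y`. -/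
theorem exists_finset_ae_mem_of_moment_sq {ν : Measure ℝ} (hpos : ∀ᵐ t ∂ν, 0 ≤ t)
    (hint : ∀ n : ℕ, Integrable (fun t : ℝ => t ^ n) ν) (hν : ν ≠ 0) {c : ℝ} (hc : c ≠ 0)
    {s : Finset ℝ} (hs : ∀ t ∈ s, t ≠ 0) (b : ℝ → ℝ)
    (hmom : ∀ n : ℕ, c * (∫ t, t ^ n ∂ν) ^ 2 = ∑ t ∈ s, b t * t ^ n) :
    ∃ s' : Finset ℝ, (∀ t ∈ s', 0 < t) ∧ ∀ᵐ t ∂ν, t ∈ s' := by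
  set P : Polynomial ℝ := (∏ t ∈ s, (Polynomial.X - Polynomial.C t)) ^ 2 with hP
  have hPs : ∀ t : ℝ, P.eval t = 0 ↔ t ∈ s := fun t => by
    simp [hP, Polynomial.eval_prod, Finset.prod_eq_zero_iff, sub_eq_zero]
  have hP0 : ∀ t : ℝ, 0 ≤ P.eval t := fun t => by
    rw [hP, Polynomial.eval_pow]; positivity
  have hPe : ∀ t, P.eval t = ∑ k ∈ Finset.range (P.natDegree + 1), P.coeff k * t ^ k := fun t =>
    Polynomial.eval_eq_sum_range t
  have hPi : ∀ x, Integrable (fun y => P.eval (x * y)) ν := fun x => by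
    simp only [hPe, mul_pow, ← mul_assoc]
    exact integrable_finsetSum _ fun k _ => (hint k).const_mul _
  set I : ℝ → ℝ := fun x => ∫ y, P.eval (x * y) ∂ν with hI
  have hI_eq : ∀ x, I x = ∑ k ∈ Finset.range (P.natDegree + 1),
      P.coeff k * (∫ y, y ^ k ∂ν) * x ^ k := fun x => by
    simp only [hI, hPe, mul_pow, ← mul_assoc]
    rw [integral_finsetSum _ fun k _ => (hint k).const_mul _]
    refine Finset.sum_congr rfl fun k _ => ?_
    rw [integral_const_mul]
    ring
  have hI_int : Integrable I ν := by
    simp only [funext hI_eq]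
    exact integrable_finsetSum _ fun k _ => (hint k).const_mul _
  have hI0 : ∫ x, I x ∂ν = 0 := by
    have h1 : c * ∫ x, I x ∂ν = ∑ t ∈ s, b t * P.eval t := by
      simp only [hI_eq]
      rw [integral_finsetSum _ fun k _ => (hint k).const_mul _, Finset.mul_sum]
      simp only [hPe, Finset.mul_sum]
      rw [Finset.sum_comm]
      refine Finset.sum_congr rfl fun k _ => ?_
      rw [integral_const_mul]
      calc _ = P.coeff k * (c * (∫ t, t ^ k ∂ν) ^ 2) := by ring
        _ = _ := by
          rw [hmom, Finset.mul_sum]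
          exact Finset.sum_congr rfl fun t _ => by ring
    rw [Finset.sum_eq_zero fun t ht => by rw [(hPs t).2 ht, mul_zero]] at h1
    exact (mul_eq_zero.1 h1).resolve_left hc
  have hI_ae : I =ᵐ[ν] 0 :=
    (integral_eq_zero_iff_of_nonneg (fun x => integral_nonneg fun y => hP0 _) hI_int).1 hI0
  have : (ae ν).NeBot := ae_neBot.2 hν
  obtain ⟨x, hx⟩ := hI_ae.exists
  have hx_ae := (integral_eq_zero_iff_of_nonneg (fun y => hP0 _) (hPi x)).1 hx
  refine ⟨(s.image (· / x)).filter (0 < ·), fun t ht => (Finset.mem_filter.1 ht).2, ?_⟩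
  filter_upwards [hx_ae, hpos] with y hy hy0
  have hmem : x * y ∈ s := (hPs _).1 hy
  have hne := hs _ hmem
  have hx0 : x ≠ 0 := left_ne_zero_of_mul hne
  have hy1 : y ≠ 0 := right_ne_zero_of_mul hne
  refine Finset.mem_filter.2 ⟨Finset.mem_image.2 ⟨x * y, hmem, ?_⟩, lt_of_le_of_ne hy0 hy1.symm⟩
  field_simp

/-! ### Charges attached to exponential sums -/

open VectorMeasure

/-- The point mass `c ↦ (re c) δ_x`. -/
noncomputable def diracRe (x : ℝ) : ℂ →+ SignedMeasure ℝ where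
  toFun c := dirac x c.re
  map_zero' := by simp
  map_add' c d := by
    ext s hs
    rw [add_apply]
    by_cases hx : x ∈ s
    · simp [hs, hx]
    · simp [hx]

/-- The charge `∑ re (c l) δ_(e^l)`, whose Mellin transform is the exponential sum with coefficients
`c` if these are real. -/
noncomputable def charge : AddMonoidAlgebra ℂ ℝ →+ SignedMeasure ℝ :=
  (Finsupp.liftAddHom fun l => diracRe (Real.exp l)).comp
    (AddMonoidAlgebra.coeffAddEquiv (R := ℂ) (M := ℝ)).toAddMonoidHom

theorem charge_apply (p : AddMonoidAlgebra ℂ ℝ) :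
    charge p = ∑ l ∈ p.coeff.support, dirac (Real.exp l) (p.coeff l).re := rfl

theorem charge_single (l : ℝ) (c : ℂ) :
    charge (AddMonoidAlgebra.single l c) = dirac (Real.exp l) c.re := by
  change (Finsupp.liftAddHom fun l => diracRe (Real.exp l)) (Finsupp.single l c) = _
  rw [Finsupp.liftAddHom_apply_single]
  rfl

theorem variation_charge_compl (p : AddMonoidAlgebra ℂ ℝ) :
    (charge p).variation ((Real.exp '' p.coeff.support)ᶜ) = 0 := by
  have hm : MeasurableSet ((Real.exp '' (p.coeff.support : Set ℝ))ᶜ) :=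
    ((p.coeff.support.finite_toSet.image _).measurableSet).compl
  rw [variation_apply_eq_zero hm]
  intro t ht _
  rw [charge_apply, FunLike.coe_sum, Finset.sum_apply]
  exact Finset.sum_eq_zero fun l hl =>
    dirac_apply_of_notMem fun h => ht h ⟨l, hl, rfl⟩

theorem chargeSupport_charge_subset (p : AddMonoidAlgebra ℂ ℝ) :
    chargeSupport (charge p) ⊆ Real.exp '' p.coeff.support :=
  Measure.support_subset_of_isClosed (p.coeff.support.finite_toSet.image _).isClosed
    (variation_charge_compl p)

theorem mellinCharge_charge {p : AddMonoidAlgebra ℂ ℝ} (hp : ∀ l, (p.coeff l).im = 0) (z : ℂ) :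
    mellinCharge (charge p) z = expSum p z := by
  have h1 : (charge p).restrict (Ioi 0) = charge p := by
    rw [charge_apply, ← restrictGm_apply, map_sum]
    exact Finset.sum_congr rfl fun l _ =>
      restrict_dirac_of_mem measurableSet_Ioi (Real.exp_pos l)
  rw [mellinCharge, h1, charge_apply, integral_finsetSum_vectorMeasure, expSum_apply]
  · refine Finset.sum_congr rfl fun l _ => ?_
    rw [VectorMeasure.integral_dirac]
    have h2 : (p.coeff l : ℂ) = ((p.coeff l).re : ℂ) := Complex.ext rfl (by simp [hp l])
    have h3 : ((Real.exp l : ℝ) : ℂ) ^ z = Complex.exp (l * z) := by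
      rw [Complex.ofReal_exp, Complex.cpow_def_of_ne_zero (Complex.exp_ne_zero _),
        ← Complex.ofReal_exp, ← Complex.ofReal_log (Real.exp_pos l).le, Real.log_exp]
    rw [h3]
    conv_rhs => rw [h2]
    simp
  · intro l _
    rw [VectorMeasure.Integrable, variation_dirac]
    exact (integrable_dirac (by simp)).smul_measure (by simp)

/-- Multiplicative convolution of charges corresponds to multiplication of exponential sums. -/
theorem mulConv_charge {p q : AddMonoidAlgebra ℂ ℝ} (hp : ∀ l, (p.coeff l).im = 0) :
    mulConv (charge p) (charge q) = charge (p * q) := by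
  have h1 : VectorMeasure.prod (charge p) (charge q) (ContinuousLinearMap.mul ℝ ℝ) =
      ∑ l ∈ p.coeff.support, ∑ m ∈ q.coeff.support,
        dirac (Real.exp l, Real.exp m) ((p.coeff l).re * (q.coeff m).re) := by
    refine prod_eq_of_forall_apply_prod fun s t hs ht => ?_
    rw [ContinuousLinearMap.mul_apply', charge_apply, charge_apply]
    simp only [FunLike.coe_sum, Finset.sum_apply, Finset.sum_mul_sum]
    refine Finset.sum_congr rfl fun l _ => Finset.sum_congr rfl fun m _ => ?_
    by_cases h1 : Real.exp l ∈ s <;> by_cases h2 : Real.exp m ∈ t <;>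
      simp [hs, ht, hs.prod ht, h1, h2]
  have h2 : p * q = ∑ l ∈ p.coeff.support, ∑ m ∈ q.coeff.support,
      AddMonoidAlgebra.single (l + m) (p.coeff l * q.coeff m) := AddMonoidAlgebra.mul_def ..
  rw [mulConv, h1, h2]
  change mapGm _ _ = _
  simp only [map_sum]
  refine Finset.sum_congr rfl fun l _ => Finset.sum_congr rfl fun m _ => ?_
  rw [charge_single, Real.exp_add, Complex.mul_re, hp l, zero_mul, sub_zero]
  ext s hs
  change (dirac _ _).map _ s = _
  have hmeas : Measurable fun p : ℝ × ℝ => p.1 * p.2 := measurable_fst.mul measurable_snd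
  rw [map_apply _ hmeas hs]
  by_cases h : Real.exp l * Real.exp m ∈ s
  · rw [dirac_apply_of_mem hs h, dirac_apply_of_mem (hmeas hs) h]
  · have h' : (Real.exp l, Real.exp m) ∉ (fun p : ℝ × ℝ => p.1 * p.2) ⁻¹' s := h
    rw [dirac_apply_of_notMem h, dirac_apply_of_notMem h']

/-- The exponential sum `∑ ν{t} t^z`, which is the Mellin transform of a measure `ν` concentrated on
the finite set `s` of positive numbers. -/
noncomputable def mellinSum (ν : Measure ℝ) (s : Finset ℝ) : AddMonoidAlgebra ℂ ℝ :=
  ∑ t ∈ s, AddMonoidAlgebra.single (Real.log t) (ν.real {t} : ℂ)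

theorem exp_log_mul {t : ℝ} (ht : 0 < t) (z : ℂ) :
    Complex.exp ((Real.log t : ℝ) * z) = (t : ℂ) ^ z := by
  rw [Complex.cpow_def_of_ne_zero (by exact_mod_cast ht.ne'), Complex.ofReal_log ht.le]

theorem expSum_mellinSum (ν : Measure ℝ) {s : Finset ℝ} (hs : ∀ t ∈ s, 0 < t) (z : ℂ) :
    expSum (mellinSum ν s) z = ∑ t ∈ s, (ν.real {t} : ℂ) * (t : ℂ) ^ z := by
  rw [mellinSum, map_sum, Finset.sum_apply]
  exact Finset.sum_congr rfl fun t ht => by rw [expSum_single, exp_log_mul (hs t ht)]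

theorem expSum_mellinSum_natCast {ν : Measure ℝ} [IsFiniteMeasure ν] {s : Finset ℝ}
    (hs : ∀ t ∈ s, 0 < t) (hν : ∀ᵐ t ∂ν, t ∈ s) (n : ℕ) :
    expSum (mellinSum ν s) n = ((∫ t, t ^ n ∂ν : ℝ) : ℂ) := by
  rw [expSum_mellinSum ν hs, integral_eq_sum_of_ae_mem hν]
  simp

theorem mellinMeasure_eq_expSum {ν : Measure ℝ} [IsFiniteMeasure ν] {s : Finset ℝ}
    (hs : ∀ t ∈ s, 0 < t) (hν : ∀ᵐ t ∂ν, t ∈ s) (z : ℂ) :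
    mellinMeasure ν z = expSum (mellinSum ν s) z := by
  have h1 : ν.restrict (Ioi 0) = ν :=
    Measure.restrict_eq_self_of_ae_mem (hν.mono fun t ht => hs t ht)
  rw [mellinMeasure, h1, integral_eq_sum_of_ae_mem hν, expSum_mellinSum ν hs]
  simp

theorem charge_mellinSum {ν : Measure ℝ} [IsFiniteMeasure ν] {s : Finset ℝ}
    (hs : ∀ t ∈ s, 0 < t) (hν : ∀ᵐ t ∂ν, t ∈ s) :
    charge (mellinSum ν s) = ν.toSignedMeasure := by
  ext E hE
  rw [mellinSum, map_sum, FunLike.coe_sum, Finset.sum_apply, Measure.toSignedMeasure_apply_measurable hE,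
    ← integral_indicator_one hE, integral_eq_sum_of_ae_mem hν]
  refine Finset.sum_congr rfl fun t ht => ?_
  rw [charge_single, Real.exp_log (hs t ht), Complex.ofReal_re]
  by_cases h : t ∈ E
  · rw [dirac_apply_of_mem hE h]; simp [h]
  · rw [dirac_apply_of_notMem h]; simp [h]

end AluthgeShift

/-! ### Square roots of Mellin transforms -/

namespace AluthgeShift

open ExpSum EntireSqrt

theorem exists_of_mem_support_sum_single {s : Finset ℝ} (g : ℝ → ℝ) (c : ℝ → ℂ) {l : ℝ}
    (hl : l ∈ (∑ t ∈ s, AddMonoidAlgebra.single (g t) (c t)).coeff.support) :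
    ∃ t ∈ s, g t = l := by
  by_contra! h
  refine Finsupp.mem_support_iff.1 hl ?_
  rw [AddMonoidAlgebra.coeff_sum, Finsupp.finsetSum_apply]
  exact Finset.sum_eq_zero fun t ht => Finsupp.single_eq_of_ne (h t ht).symm

/-- The Mellin transform of a finitely atomic measure is its dominant term times a perturbation of
`1` with negative frequencies. -/
theorem exists_mellinSum_eq_dominant {μ : Measure ℝ} {s : Finset ℝ} (hs : ∀ t ∈ s, 0 < t)
    (hne : s.Nonempty) (ha : ∀ t ∈ s, 0 < μ.real {t}) :
    ∃ (B : ℂ) (L : ℝ) (w : AddMonoidAlgebra ℂ ℝ), B ≠ 0 ∧ (∀ l ∈ w.coeff.support, l < 0) ∧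
      ∀ z, expSum (mellinSum μ s) z = B ^ 2 * Complex.exp (L * z) * (1 + expSum w z) := by
  set T := s.max' hne with hT
  have hTs : T ∈ s := s.max'_mem hne
  have haT := ha T hTs
  have haT' : (μ.real {T} : ℂ) ≠ 0 := by exact_mod_cast haT.ne'
  refine ⟨(Real.sqrt (μ.real {T}) : ℝ), Real.log T, ∑ t ∈ s.erase T,
    AddMonoidAlgebra.single (Real.log t - Real.log T) (μ.real {t} / μ.real {T} : ℂ), ?_, ?_, ?_⟩
  · exact_mod_cast (Real.sqrt_pos.2 haT).ne'
  · intro l hl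
    obtain ⟨t, ht, rfl⟩ := exists_of_mem_support_sum_single _ _ hl
    obtain ⟨htT, hts⟩ := Finset.mem_erase.1 ht
    exact sub_neg.2 (Real.log_lt_log (hs t hts) (lt_of_le_of_ne (s.le_max' t hts) htT))
  · intro z
    rw [mellinSum, ← Finset.add_sum_erase s _ hTs, ← Complex.ofReal_pow, Real.sq_sqrt haT.le,
      mul_add, mul_one, map_add, Pi.add_apply, expSum_single, map_sum, map_sum, Finset.sum_apply,
      Finset.sum_apply, Finset.mul_sum]
    congr 1
    refine Finset.sum_congr rfl fun t _ => ?_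
    rw [expSum_single, expSum_single]
    have : Complex.exp (Real.log t * z) = Complex.exp (Real.log T * z) *
        Complex.exp ((Real.log t - Real.log T : ℝ) * z) := by
      rw [← Complex.exp_add]; congr 1; push_cast; ring
    rw [this]
    field_simp

theorem nonneg_of_mem_support_mellinSum {μ : Measure ℝ} {s : Finset ℝ} (hs : ∀ t ∈ s, 1 ≤ t) :
    ∀ l ∈ (mellinSum μ s).coeff.support, 0 ≤ l := by
  intro l hl
  obtain ⟨t, ht, rfl⟩ := exists_of_mem_support_sum_single _ _ hl
  exact Real.log_nonneg (hs t ht)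

/-- An exponential sum whose square takes positive values at the natural numbers has real
coefficients. -/
theorem im_coeff_eq_zero_of_sq_pos {p : AddMonoidAlgebra ℂ ℝ}
    (hp : ∀ n : ℕ, ∃ r : ℝ, 0 < r ∧ expSum p n ^ 2 = r) (l : ℝ) : (p.coeff l).im = 0 := by
  set q : AddMonoidAlgebra ℂ ℝ :=
    ∑ l ∈ p.coeff.support, AddMonoidAlgebra.single l (starRingEnd ℂ (p.coeff l)) with hq
  have hqp : q = p := by
    refine expSum_eq_of_forall_nat fun n => ?_
    obtain ⟨r, hr, hpr⟩ := hp n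
    have h1 : expSum q n = starRingEnd ℂ (expSum p n) := by
      rw [hq, map_sum, Finset.sum_apply, expSum_apply, map_sum]
      refine Finset.sum_congr rfl fun l _ => ?_
      rw [expSum_single, map_mul, ← Complex.exp_conj, map_mul, Complex.conj_ofReal,
        Complex.conj_natCast]
    have h2 : expSum p n ^ 2 = ((Real.sqrt r : ℝ) : ℂ) ^ 2 := by
      rw [hpr, ← Complex.ofReal_pow, Real.sq_sqrt hr.le]
    rw [h1]
    rcases sq_eq_sq_iff_eq_or_eq_neg.1 h2 with h | h <;> simp [h]
  have h3 : q.coeff l = starRingEnd ℂ (p.coeff l) := by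
    rw [hq, AddMonoidAlgebra.coeff_sum, Finsupp.finsetSum_apply]
    simp only [AddMonoidAlgebra.coeff_single, Finsupp.single_apply, Finset.sum_ite_eq']
    split_ifs with h
    · rfl
    · rw [Finsupp.notMem_support_iff.1 h, map_zero]
  rw [hqp] at h3
  exact Complex.conj_eq_iff_im.1 h3.symm

/-- Subnormality of the Aluthge transform makes the product of the Mellin transform of the Berger
measure with its translate the square of an exponential sum. -/
theorem exists_expSum_sq_eq {α : ℕ → ℝ} {W S : Seq2 →L[ℂ] Seq2} (hW : IsWeightedShift α W)
    {μ : Measure ℝ} [IsFiniteMeasure μ] (hμ : IsBergerMeasure α W μ)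
    (hS : IsAluthgeTransform W S) (hSsub : IsSubnormal S) {s : Finset ℝ} (hs : ∀ t ∈ s, 0 < t)
    (hsμ : ∀ᵐ t ∂μ, t ∈ s) :
    ∃ k : AddMonoidAlgebra ℂ ℝ, ∀ z,
      expSum (mellinSum μ s) z * expSum (mellinSum μ s) (z + 1) = expSum k z ^ 2 := by
  obtain ⟨ν, hνfin, hνpos, hνint, hνmom⟩ := hSsub.exists_measure_moment (e 0)
  set β : ℕ → ℝ := fun n => Real.sqrt (α n) * Real.sqrt (α (n + 1)) with hβ
  have hν_eq : ∀ n : ℕ, ∫ t, t ^ n ∂ν = gammaSeq β n := fun n => by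
    rw [hνmom, (hW.aluthge hS).norm_sq_pow_apply]
  have hγ1 : 0 < gammaSeq α 1 := Finset.prod_pos fun k _ => pow_pos (hW.weight_pos k) 2
  have hγ : ∀ n : ℕ, gammaSeq α 1 * (∫ t, t ^ n ∂ν) ^ 2 =
      (∫ t, t ^ n ∂μ) * ∫ t, t ^ (n + 1) ∂μ := fun n => by
    rw [hν_eq, hμ.moment_eq, hμ.moment_eq, gammaSeq_mul_succ hW.weight_pos]
  have hν0 : ν ≠ 0 := by
    rintro rfl
    have := hν_eq 0
    simp [gammaSeq] at this
  -- `γ n * γ (n + 1)` is the moment sequence of a combination of masses at the products of atoms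
  have hprod : ∃ (s₂ : Finset ℝ) (b : ℝ → ℝ), (∀ t ∈ s₂, t ≠ 0) ∧ ∀ n : ℕ,
      gammaSeq α 1 * (∫ t, t ^ n ∂ν) ^ 2 = ∑ t ∈ s₂, b t * t ^ n := by
    refine ⟨(s ×ˢ s).image fun x => x.1 * x.2, fun t => ∑ x ∈ s ×ˢ s with x.1 * x.2 = t,
      μ.real {x.1} * μ.real {x.2} * x.2, fun t ht => ?_, fun n => ?_⟩
    · obtain ⟨x, hx, rfl⟩ := Finset.mem_image.1 ht
      have hx' := Finset.mem_product.1 hx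
      exact (mul_pos (hs _ hx'.1) (hs _ hx'.2)).ne'
    · rw [hγ, integral_eq_sum_of_ae_mem hsμ, integral_eq_sum_of_ae_mem hsμ, Finset.sum_mul_sum,
        ← Finset.sum_product', ← Finset.sum_fiberwise_of_maps_to
          (fun x hx => Finset.mem_image_of_mem (fun x : ℝ × ℝ => x.1 * x.2) hx)]
      refine Finset.sum_congr rfl fun t _ => ?_
      rw [Finset.sum_mul]
      refine Finset.sum_congr rfl fun x hx => ?_
      rw [← (Finset.mem_filter.1 hx).2, smul_eq_mul, smul_eq_mul]
      ring
  obtain ⟨s₂, b, hs₂, hb⟩ := hprod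
  obtain ⟨s', hs', hνs'⟩ := exists_finset_ae_mem_of_moment_sq hνpos hνint hν0 hγ1.ne' hs₂ b hb
  set k : AddMonoidAlgebra ℂ ℝ :=
    (Real.sqrt (gammaSeq α 1) : ℂ) • mellinSum ν s' with hk
  obtain ⟨f₁, hf₁⟩ := exists_expSum_translate (mellinSum μ s)
  have key : mellinSum μ s * f₁ = k ^ 2 := by
    refine expSum_eq_of_forall_nat fun n => ?_
    have h1 : expSum f₁ n = ((∫ t, t ^ (n + 1) ∂μ : ℝ) : ℂ) := by
      rw [hf₁, ← expSum_mellinSum_natCast hs hsμ]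
      push_cast
      rfl
    rw [map_mul, Pi.mul_apply, h1, expSum_mellinSum_natCast hs hsμ, hk, map_pow, map_smul,
      Pi.pow_apply, Pi.smul_apply, expSum_mellinSum_natCast hs' hνs', smul_eq_mul, mul_pow,
      ← Complex.ofReal_pow, Real.sq_sqrt hγ1.le, ← Complex.ofReal_mul, ← hγ]
    push_cast
    rfl
  refine ⟨k, fun z => ?_⟩
  rw [← hf₁, ← Pi.mul_apply, ← map_mul, key, map_pow, Pi.pow_apply]

end AluthgeShift

theorem theorem3p4 (α : ℕ → ℝ)
    (W S : AluthgeShift.Seq2 →L[ℂ] AluthgeShift.Seq2)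
    (hW : AluthgeShift.IsWeightedShift α W)
    (hWsub : AluthgeShift.IsSubnormal W)
    (μ : Measure ℝ) [IsFiniteMeasure μ]
    (hμ : AluthgeShift.IsBergerMeasure α W μ)
    (hμfin : μ.support.Finite)
    (hμsupp : μ.support ⊆ Ici (1 : ℝ))
    (hS : AluthgeShift.IsAluthgeTransform W S)
    (hSsub : AluthgeShift.IsSubnormal S) :
    (∃ H : ℂ → ℂ, Differentiable ℂ H ∧ ∀ z, H z ^ 2 = AluthgeShift.mellinMeasure μ z) ∧
    ∀ H : ℂ → ℂ, Differentiable ℂ H → (∀ z, H z ^ 2 = AluthgeShift.mellinMeasure μ z) →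
      ∃ ξ : SignedMeasure ℝ,
        (AluthgeShift.chargeSupport ξ).Finite ∧
        AluthgeShift.chargeSupport ξ ⊆ Ici (1 : ℝ) ∧
        (∀ z, AluthgeShift.mellinCharge ξ z = H z) ∧
        AluthgeShift.mulConv ξ ξ = μ.toSignedMeasure := by
  open AluthgeShift ExpSum EntireSqrt in
  set s : Finset ℝ := hμfin.toFinset with hs_def
  have hs1 : ∀ t ∈ s, 1 ≤ t := fun t ht => hμsupp (hμfin.mem_toFinset.1 ht)
  have hs : ∀ t ∈ s, 0 < t := fun t ht => one_pos.trans_le (hs1 t ht)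
  have hsμ : ∀ᵐ t ∂μ, t ∈ s := by
    filter_upwards [Measure.support_mem_ae (μ := μ)] with t ht using hμfin.mem_toFinset.2 ht
  have hγpos : ∀ n : ℕ, 0 < gammaSeq α n := fun n =>
    Finset.prod_pos fun k _ => pow_pos (hW.weight_pos k) 2
  have hne : s.Nonempty := by
    rw [Finset.nonempty_iff_ne_empty]
    intro h
    have h1 := hμ.moment_eq 0
    rw [integral_eq_sum_of_ae_mem hsμ, h, Finset.sum_empty] at h1
    exact (hγpos 0).ne h1
  obtain ⟨B, L, w, hB, hw, hF⟩ := exists_mellinSum_eq_dominant hs hne fun t ht =>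
    measureReal_singleton_pos hμfin (hμfin.mem_toFinset.1 ht)
  simp only [mellinMeasure_eq_expSum hs hsμ]
  constructor
  · obtain ⟨k, hk⟩ := exists_expSum_sq_eq hW hμ hS hSsub hs hsμ
    obtain ⟨x, -, hx⟩ := exists_forall_norm_expSum_lt w hw one_pos
    exact exists_entire_sqrt (x := x) (h := sqrtBranch B L w) (differentiable_expSum _)
      (differentiable_expSum k) hk (fun z hz => analyticAt_sqrtBranch B L (hx z hz))
      (fun z _ => by rw [sqrtBranch_sq, hF]) (fun z hz => sqrtBranch_ne_zero hB L (hx z hz))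
  · intro H hH hsq
    obtain ⟨p, hp0, hp⟩ := exists_expSum_eq_of_sq hH B hB L w hw
      (fun z => by rw [hsq, hF]) fun x => by
        obtain ⟨C, hC⟩ := exists_bound_of_nonneg _ (nonneg_of_mem_support_mellinSum (μ := μ) hs1) x
        exact ⟨C, fun z hz => by rw [← norm_pow, hsq]; exact hC z hz⟩
    have hpim : ∀ l, (p.coeff l).im = 0 := im_coeff_eq_zero_of_sq_pos fun n =>
      ⟨gammaSeq α n, hγpos n, by
        rw [hp, hsq, expSum_mellinSum_natCast hs hsμ, hμ.moment_eq]⟩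
    have hpp : p * p = mellinSum μ s := expSum_injective <| by
      ext z
      rw [map_mul, Pi.mul_apply, hp, ← sq, hsq]
    have hsub := chargeSupport_charge_subset p
    refine ⟨charge p, (p.coeff.support.finite_toSet.image _).subset hsub, fun t ht => ?_,
      fun z => by rw [mellinCharge_charge hpim, hp], ?_⟩
    · obtain ⟨l, hl, rfl⟩ := hsub ht
      exact Real.one_le_exp (hp0 l hl)
    · rw [mulConv_charge hpim, hpp, charge_mellinSum hs hsμ]
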